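/- For an integer $n\ge 1$, let $O_n$ be the linear crossed octagonal graph with $n$ octagons: the simple graph with the $6n+2$ vertices $1,2,\dots,3n+1$ and $1',2',\dots,(3n+1)'$ and the following $13n+1$ edges: the path edges $\{i,i+1\}$ and $\{i',(i+1)'\}$ and the crossed edges $\{i,(i+1)'\}$ and $\{i',i+1\}$ for $1\le i\le 3n$, and the rungs $\{3k+1,(3k+1)'\}$ for $0\le k\le n$. Let $d_x$ be the degree of the vertex $x$, and let $r_{xy}$ be the resistance distance between $x$ and $y$, that is, the effective resistance between $x$ and $y$ when every edge of $O_n$ is replaced by a unit resistor. Then the multiplicative degree-Kirchhoff index of $O_n$ is $$Kf^*(O_n)=\sum_{\{x,y\}} d_x\,d_y\,r_{xy}=\frac{507n^3+559n^2+204n+8}{6},$$ where the sum runs over all unordered pairs of distinct vertices of $O_n$. -/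

import Mathlib

/-- The graph `G` is regarded as an electrical network with a unit resistor on each edge.
`v` is a potential that drives a unit current from `i` to `j`: by Ohm's law the current through
an edge from `x` to `y` is `v x - v y`, and by Kirchhoff's current law the net current leaving
the vertex `x` is `1` at the source `i`, `-1` at the sink `j`, and `0` at all other vertices
(it is `0` everywhere if `i = j`). -/
def SimpleGraph.IsUnitCurrentPotential {V : Type*} [Fintype V] [DecidableEq V]
    (G : SimpleGraph V) [DecidableRel G.Adj] (i j : V) (v : V → ℝ) : Prop :=
  ∀ x : V, ∑ y ∈ G.neighborFinset x, (v x - v y) =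
    (if x = i then 1 else 0) - (if x = j then 1 else 0)

open Classical in
/-- The resistance distance between `i` and `j`: the potential difference between `i` and `j`
when a unit current flows from `i` to `j` and every edge of `G` is a unit resistor.
It does not depend on the potential chosen, and a potential exists if `G` is connected
(both are proved below); if there is none, the value is `0` by convention. -/
noncomputable def SimpleGraph.resistanceDist {V : Type*} [Fintype V] [DecidableEq V]
    (G : SimpleGraph V) [DecidableRel G.Adj] (i j : V) : ℝ :=
  if h : ∃ v : V → ℝ, G.IsUnitCurrentPotential i j v then h.choose i - h.choose j else 0

theorem SimpleGraph.isUnitCurrentPotential_iff {V : Type*} [Fintype V] [DecidableEq V]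
    (G : SimpleGraph V) [DecidableRel G.Adj] (i j : V) (v : V → ℝ) :
    G.IsUnitCurrentPotential i j v ↔
      (G.lapMatrix ℝ).mulVec v = Pi.single i 1 - Pi.single j 1 := by
  rw [funext_iff]
  refine forall_congr' fun x => ?_
  rw [SimpleGraph.lapMatrix_mulVec_apply, Finset.sum_sub_distrib]
  simp [Pi.single_apply]

theorem SimpleGraph.IsUnitCurrentPotential.sub_eq_sub {V : Type*} [Fintype V] [DecidableEq V]
    {G : SimpleGraph V} [DecidableRel G.Adj] {i j : V} {v w : V → ℝ}
    (hv : G.IsUnitCurrentPotential i j v) (hw : G.IsUnitCurrentPotential i j w) :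
    v i - v j = w i - w j := by
  rw [SimpleGraph.isUnitCurrentPotential_iff] at hv hw
  -- pair the two equations and use the symmetry of the Laplacian
  have hs : ∀ a b : V → ℝ, a ⬝ᵥ (G.lapMatrix ℝ).mulVec b = b ⬝ᵥ (G.lapMatrix ℝ).mulVec a := by
    intro a b
    rw [Matrix.dotProduct_mulVec, ← Matrix.mulVec_transpose,
      (G.isSymm_lapMatrix (R := ℝ)).eq, dotProduct_comm]
  have h := hs v w
  rw [hv, hw] at h
  simpa [dotProduct_sub] using h

/-- The resistance distance can be computed from any potential. -/
theorem SimpleGraph.IsUnitCurrentPotential.resistanceDist_eq {V : Type*} [Fintype V]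
    [DecidableEq V] {G : SimpleGraph V} [DecidableRel G.Adj] {i j : V} {v : V → ℝ}
    (hv : G.IsUnitCurrentPotential i j v) : G.resistanceDist i j = v i - v j := by
  have h : ∃ v : V → ℝ, G.IsUnitCurrentPotential i j v := ⟨v, hv⟩
  rw [SimpleGraph.resistanceDist, dif_pos h]
  exact h.choose_spec.sub_eq_sub hv

/-- In a connected graph a unit current can be driven between any two vertices. -/
theorem SimpleGraph.Connected.exists_isUnitCurrentPotential {V : Type*} [Fintype V]
    [DecidableEq V] {G : SimpleGraph V} [DecidableRel G.Adj] (hG : G.Connected) (i j : V) :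
    ∃ v : V → ℝ, G.IsUnitCurrentPotential i j v := by
  have hone : ∀ x : V → ℝ, ∑ k, (G.lapMatrix ℝ).mulVec x k = 0 := by
    intro x
    have h : (fun _ => (1 : ℝ)) ⬝ᵥ (G.lapMatrix ℝ).mulVec x = 0 := by
      rw [Matrix.dotProduct_mulVec, ← Matrix.mulVec_transpose,
        (G.isSymm_lapMatrix (R := ℝ)).eq, SimpleGraph.lapMatrix_mulVec_const_eq_zero,
        zero_dotProduct]
    simpa [dotProduct] using h
  have hcard : (Fintype.card V : ℝ) ≠ 0 := by
    have : 0 < Fintype.card V := Fintype.card_pos_iff.mpr ⟨i⟩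
    positivity
  have key : ∀ x b : V → ℝ, ∑ k, b k = 0 →
      (∀ k, (G.lapMatrix ℝ).mulVec x k + ∑ l, x l = b k) → ∑ l, x l = 0 := by
    intro x b hb h
    have h1 : ∑ k, ((G.lapMatrix ℝ).mulVec x k + ∑ l, x l) = 0 := by
      rw [← hb]
      exact Finset.sum_congr rfl fun k _ => h k
    rw [Finset.sum_add_distrib, hone, zero_add, Finset.sum_const, Finset.card_univ,
      nsmul_eq_mul] at h1
    exact (mul_eq_zero.mp h1).resolve_left hcard
  let f : (V → ℝ) →ₗ[ℝ] (V → ℝ) :=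
    { toFun := fun x k => (G.lapMatrix ℝ).mulVec x k + ∑ l, x l
      map_add' := fun x y => by
        funext k
        simp only [Matrix.mulVec_add, Pi.add_apply, Finset.sum_add_distrib]
        ring
      map_smul' := fun c x => by
        funext k
        simp only [Matrix.mulVec_smul, Pi.smul_apply, smul_eq_mul, RingHom.id_apply,
          ← Finset.mul_sum]
        ring }
  have hf : Function.Injective f := by
    rw [injective_iff_map_eq_zero]
    intro x hx
    have hx' : ∀ k, (G.lapMatrix ℝ).mulVec x k + ∑ l, x l = (0 : V → ℝ) k := congrFun hx
    have hs := key x 0 (by simp) hx'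
    have hL : (G.lapMatrix ℝ).mulVec x = 0 := by
      funext k
      simpa [hs] using hx' k
    rw [SimpleGraph.lapMatrix_mulVec_eq_zero_iff_forall_reachable] at hL
    have hc : ∀ k l, x k = x l := fun k l => hL k l (hG.preconnected k l)
    funext k
    have : ∑ l, x l = Fintype.card V * x k := by
      rw [Finset.sum_congr rfl fun l _ => hc l k]
      simp
    rw [hs] at this
    exact (mul_eq_zero.mp this.symm).resolve_left hcard
  obtain ⟨v, hv⟩ := (LinearMap.injective_iff_surjective.mp hf)
    (Pi.single i 1 - Pi.single j 1 : V → ℝ)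
  have hv' : ∀ k, (G.lapMatrix ℝ).mulVec v k + ∑ l, v l =
    (Pi.single i 1 - Pi.single j 1 : V → ℝ) k := congrFun hv
  have hs := key v _ (by simp) hv'
  refine ⟨v, (G.isUnitCurrentPotential_iff i j v).mpr ?_⟩
  funext k
  rw [← hv' k, hs, add_zero]

theorem SimpleGraph.IsUnitCurrentPotential.neg {V : Type*} [Fintype V] [DecidableEq V]
    {G : SimpleGraph V} [DecidableRel G.Adj] {i j : V} {v : V → ℝ}
    (hv : G.IsUnitCurrentPotential i j v) : G.IsUnitCurrentPotential j i (-v) := by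
  rw [SimpleGraph.isUnitCurrentPotential_iff] at *
  rw [Matrix.mulVec_neg, hv, neg_sub]

theorem SimpleGraph.resistanceDist_comm {V : Type*} [Fintype V] [DecidableEq V]
    (G : SimpleGraph V) [DecidableRel G.Adj] (i j : V) :
    G.resistanceDist i j = G.resistanceDist j i := by
  by_cases h : ∃ v : V → ℝ, G.IsUnitCurrentPotential i j v
  · obtain ⟨v, hv⟩ := h
    rw [hv.resistanceDist_eq, hv.neg.resistanceDist_eq]
    simp only [Pi.neg_apply]
    ring
  · have h' : ¬ ∃ v : V → ℝ, G.IsUnitCurrentPotential j i v :=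
      fun ⟨v, hv⟩ => h ⟨-v, hv.neg⟩
    rw [SimpleGraph.resistanceDist, SimpleGraph.resistanceDist, dif_neg h, dif_neg h']

/-- The multiplicative degree-Kirchhoff index: the sum of `d_i * d_j * r_ij` over all unordered
pairs of distinct vertices `i`, `j`. -/
noncomputable def SimpleGraph.multDegreeKirchhoffIndex {V : Type*} [Fintype V] [DecidableEq V]
    (G : SimpleGraph V) [DecidableRel G.Adj] : ℝ :=
  ∑ e : Sym2 V with ¬ e.IsDiag,
    Sym2.lift ⟨fun i j => (G.degree i : ℝ) * (G.degree j : ℝ) * G.resistanceDist i j,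
      fun i j => by
        simp only [G.resistanceDist_comm i j, mul_comm (G.degree i : ℝ)]⟩ e

/-- The linear crossed octagonal graph with `n` octagons. The vertices `(k, false)` and
`(k, true)` are the `(k+1)`-st vertices of the upper and the lower path, `k = 0, …, 3n`.
Consecutive columns are joined completely (the edges of the two paths together with the crossed
edges), and the two vertices of column `k` are joined (a rung) exactly when `3 ∣ k`. -/
def crossedOctagonalGraph (n : ℕ) : SimpleGraph (Fin (3 * n + 1) × Bool) where
  Adj a b :=
    (a.1 : ℕ) + 1 = b.1 ∨ (b.1 : ℕ) + 1 = a.1 ∨ (a.1 = b.1 ∧ a.2 ≠ b.2 ∧ 3 ∣ (a.1 : ℕ))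
  symm := by
    constructor
    rintro a b (h | h | ⟨h1, h2, h3⟩)
    · exact Or.inr (Or.inl h)
    · exact Or.inl h
    · exact Or.inr (Or.inr ⟨h1.symm, h2.symm, h1 ▸ h3⟩)
  loopless := by
    constructor
    rintro a (h | h | ⟨-, h2, -⟩)
    · omega
    · omega
    · exact h2 rfl

instance (n : ℕ) : DecidableRel (crossedOctagonalGraph n).Adj := fun a b =>
  inferInstanceAs (Decidable ((a.1 : ℕ) + 1 = b.1 ∨ (b.1 : ℕ) + 1 = a.1 ∨
    (a.1 = b.1 ∧ a.2 ≠ b.2 ∧ 3 ∣ (a.1 : ℕ))))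

/-- The linear crossed octagonal graph is connected, so all its resistance
distances are defined by actual potentials. -/
theorem crossedOctagonalGraph_connected (n : ℕ) : (crossedOctagonalGraph n).Connected := by
  have h0 : ∀ (k : ℕ) (hk : k < 3 * n + 1) (b : Bool),
      (crossedOctagonalGraph n).Reachable (⟨k, hk⟩, b) (⟨0, by omega⟩, false) := by
    intro k
    induction k with
    | zero =>
      intro hk b
      cases b
      · exact SimpleGraph.Reachable.refl _
      · exact SimpleGraph.Adj.reachable (Or.inr (Or.inr ⟨rfl, by simp, by simp⟩))
    | succ k ih =>
      intro hk b
      exact (SimpleGraph.Adj.reachable (Or.inr (Or.inl rfl))).trans (ih (by omega) b)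
  have : Nonempty (Fin (3 * n + 1) × Bool) := ⟨(⟨0, by omega⟩, false)⟩
  exact ⟨fun a b => (h0 a.1 a.1.2 a.2).trans (h0 b.1 b.1.2 b.2).symm⟩

/-! ### Column data and neighbour sums. -/

open Finset

/-! Exchanging the two vertices of a column is an automorphism, so the Laplacian splits. On
functions antisymmetric in each column it is diagonal, with entries `columnEigenvalue`. On functions
constant on columns it is that of a path, consecutive columns being joined by four parallel edges.
Hence a potential can be written down explicitly (`sum_neighborFinset_sourcePotential`), and it
yields every resistance (`crossedOctagonalGraph_resistanceDist`).

In the sum over pairs the antisymmetric correction inside a column cancels. What remains is the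
degree-weighted sum of column distances and a product of two single sums over columns, all evaluated
by induction on `n`. -/

/-- The indicator of the columns that carry a rung. -/
def rungIndicator (k : ℕ) : ℝ := if 3 ∣ k then 1 else 0

/-- The common degree of the two vertices of column `k`. -/
def columnDegree (n k : ℕ) : ℝ :=
  (if 1 ≤ k then 2 else 0) + (if k < 3 * n then 2 else 0) + rungIndicator k

/-- The eigenvalue of the Laplacian on the function that is `1` and `-1` on the two vertices of
column `k` and `0` elsewhere. -/
def columnEigenvalue (n k : ℕ) : ℝ := columnDegree n k + rungIndicator k

def boolSign (s t : Bool) : ℝ := if s = t then 1 else -1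

theorem crossedOctagonalGraph_sum_neighborFinset (n : ℕ) (x : Fin (3 * n + 1) × Bool)
    (F : ℕ → Bool → ℝ) :
    ∑ y ∈ (crossedOctagonalGraph n).neighborFinset x, F y.1 y.2 =
      (if 1 ≤ (x.1 : ℕ) then F (x.1 - 1) false + F (x.1 - 1) true else 0) +
      (if (x.1 : ℕ) < 3 * n then F (x.1 + 1) false + F (x.1 + 1) true else 0) +
      rungIndicator x.1 * F x.1 (!x.2) := by
  obtain ⟨⟨k, hk⟩, s⟩ := x
  have h1 : ∑ y ∈ (crossedOctagonalGraph n).neighborFinset (⟨k, hk⟩, s), F y.1 y.2 =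
      ∑ m ∈ range (3 * n + 1),
        -- The inner guard `1 ≤ k` is needed because `0 - 1 = 0` would otherwise give column 0 a
        -- left neighbour.
        ((if k - 1 = m then (if 1 ≤ k then F m false + F m true else 0) else 0) +
        (if k + 1 = m then F m false + F m true else 0) +
        (if k = m then rungIndicator k * F m (!s) else 0)) := by
    rw [SimpleGraph.neighborFinset_eq_filter, sum_filter, Fintype.sum_prod_type, sum_range]
    refine sum_congr rfl fun m _ => ?_
    have hadj : ∀ u, (crossedOctagonalGraph n).Adj (⟨k, hk⟩, s) (m, u) ↔
        k + 1 = m ∨ (m : ℕ) + 1 = k ∨ (k = m ∧ s ≠ u ∧ 3 ∣ k) := by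
      intro u
      simp [crossedOctagonalGraph, Fin.ext_iff]
    simp only [hadj, Fintype.sum_bool, rungIndicator]
    rcases lt_trichotomy k (m : ℕ) with h | h | h
    · have a1 : ¬ k - 1 = m := by omega
      have a2 : ¬ (m : ℕ) + 1 = k := by omega
      have a3 : ¬ k = m := by omega
      by_cases h4 : k + 1 = m <;> simp [*, add_comm]
    · have a1 : (k - 1 = m) → ¬ 1 ≤ k := by omega
      have a2 : ¬ (m : ℕ) + 1 = k := by omega
      have a3 : ¬ k + 1 = m := by omega
      by_cases h3 : 3 ∣ k <;> cases s <;> by_cases h1 : 1 ≤ k <;> simp_all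
    · have a3 : ¬ k = m := by omega
      have a2 : ¬ k + 1 = m := by omega
      have a1 : (k - 1 = m) ↔ (m : ℕ) + 1 = k := by omega
      have a4 : 1 ≤ k := by omega
      by_cases h4 : (m : ℕ) + 1 = k <;> simp [*, add_comm]
  rw [h1, sum_add_distrib, sum_add_distrib, sum_ite_eq, sum_ite_eq, sum_ite_eq]
  have b1 : k - 1 ∈ range (3 * n + 1) := by simp; omega
  have b2 : (k + 1 ∈ range (3 * n + 1)) ↔ k < 3 * n := by simp
  have b3 : k ∈ range (3 * n + 1) := by simpa using hk
  simp only [b1, b2, b3, if_true]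

theorem crossedOctagonalGraph_degree (n : ℕ) (x : Fin (3 * n + 1) × Bool) :
    ((crossedOctagonalGraph n).degree x : ℝ) = columnDegree n x.1 := by
  have h := crossedOctagonalGraph_sum_neighborFinset n x fun _ _ => 1
  rw [sum_const, nsmul_eq_mul, mul_one, SimpleGraph.card_neighborFinset_eq_degree] at h
  rw [h, columnDegree]
  norm_num

theorem rungIndicator_nonneg (k : ℕ) : 0 ≤ rungIndicator k := by
  unfold rungIndicator; split_ifs <;> norm_num

theorem columnEigenvalue_pos {n : ℕ} (hn : 1 ≤ n) (k : ℕ) : 0 < columnEigenvalue n k := by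
  have := rungIndicator_nonneg k
  unfold columnEigenvalue columnDegree
  split_ifs <;> first | (exfalso; omega) | linarith

/-! ### Explicit potentials and resistance distances. -/

/-- The potential of a unit current entering at `(k, s)` and leaving at the two end columns. -/
noncomputable def sourcePotential (n k : ℕ) (s : Bool) (m : ℕ) (u : Bool) : ℝ :=
  -|(m : ℝ) - k| / 8 + if m = k then boolSign s u / (2 * columnEigenvalue n k) else 0

/-- The current leaves through the four end vertices, 1/4 at each, wherever the source is; the
drains therefore cancel in the difference of two such potentials. Half a unit flows to each side of
the source through four edges per step, whence the slope 1/8. -/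
theorem sum_neighborFinset_sourcePotential {n : ℕ} (hn : 1 ≤ n)
    (i x : Fin (3 * n + 1) × Bool) :
    ∑ y ∈ (crossedOctagonalGraph n).neighborFinset x,
      (sourcePotential n i.1 i.2 x.1 x.2 - sourcePotential n i.1 i.2 y.1 y.2) =
    (if x = i then 1 else 0) -
      ((if (x.1 : ℕ) = 0 then 1 / 4 else 0) + if (x.1 : ℕ) = 3 * n then 1 / 4 else 0) := by
  rw [crossedOctagonalGraph_sum_neighborFinset n x fun m u =>
    sourcePotential n i.1 i.2 x.1 x.2 - sourcePotential n i.1 i.2 m u]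
  obtain ⟨⟨m, hm⟩, u⟩ := x
  obtain ⟨⟨k, hk⟩, s⟩ := i
  have hc := (columnEigenvalue_pos hn k).ne'
  have hflip : boolSign s (!u) = -boolSign s u := by cases s <;> cases u <;> simp [boolSign]
  have hpair : boolSign s true = -boolSign s false := by cases s <;> simp [boolSign]
  have hx : (((⟨m, hm⟩, u) : Fin (3 * n + 1) × Bool) = (⟨k, hk⟩, s)) ↔ m = k ∧ s = u := by
    simp [Prod.ext_iff, Fin.ext_iff, eq_comm]
  have hanti : ∀ p, (if p = k then boolSign s false / (2 * columnEigenvalue n k) else 0) +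
      (if p = k then boolSign s true / (2 * columnEigenvalue n k) else 0) = 0 := by
    intro p
    rw [hpair]; split_ifs <;> ring
  simp only [hx, sourcePotential]
  set A : ℝ := if m = k then boolSign s u / (2 * columnEigenvalue n k) else 0 with hA
  have hrung : (if m = k then boolSign s (!u) / (2 * columnEigenvalue n k) else 0) = -A := by
    rw [hflip, hA]; split_ifs <;> ring
  -- The unit source at one vertex is 1/2 on both vertices of its column plus an antisymmetric ±1/2,
  -- and the latter is divided by the eigenvalue.
  have hsource : (if m = k ∧ s = u then (1 : ℝ) else 0) =
      (if m = k then 1 / 2 else 0) + columnEigenvalue n m * A := by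
    rw [hA]
    by_cases h : m = k
    · subst h
      by_cases hs : s = u <;> simp [hs, boolSign] <;> field_simp <;> norm_num
    · simp [h]
  have hL := hanti (m - 1)
  have hR := hanti (m + 1)
  rw [hrung, hsource]
  -- Second difference of `|m - k|`: a kink at the source, and a missing neighbour at each end of
  -- the path producing the drain. The two vertices of a column turn 1/8 into 1/4.
  have hpath : (if 1 ≤ m then (|((m - 1 : ℕ) : ℝ) - k| - |(m : ℝ) - k|) / 4 else 0) +
      (if m < 3 * n then (|((m + 1 : ℕ) : ℝ) - k| - |(m : ℝ) - k|) / 4 else 0) =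
      (if m = k then 1 / 2 else 0) -
      ((if m = 0 then 1 / 4 else 0) + if m = 3 * n then 1 / 4 else (0 : ℝ)) := by
    have e1 : 1 ≤ m → ((m - 1 : ℕ) : ℝ) = m - 1 := fun h => by push_cast [h]; ring
    rcases lt_trichotomy m k with h | h | h
    · have h' : (m : ℝ) + 1 ≤ k := by exact_mod_cast h
      rw [abs_of_nonpos (by linarith : (m : ℝ) - k ≤ 0),
        abs_of_nonpos (by push_cast; linarith : ((m + 1 : ℕ) : ℝ) - k ≤ 0)]
      by_cases h1 : 1 ≤ m
      · rw [e1 h1, abs_of_nonpos (by linarith : (m : ℝ) - 1 - k ≤ 0)]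
        simp [h1, show m < 3 * n by omega, show m ≠ k by omega, show m ≠ 0 by omega,
          show m ≠ 3 * n by omega]
        ring
      · obtain rfl : m = 0 := by omega
        simp [show 0 < n by omega, show 0 ≠ k by omega, show n ≠ 0 by omega]; norm_num
    · subst h
      by_cases h1 : 1 ≤ m
      · rw [e1 h1]
        by_cases h2 : m < 3 * n
        · simp [h1, h2, show m ≠ 0 by omega, show m ≠ 3 * n by omega]; norm_num
        · simp [show m = 3 * n by omega, show n ≠ 0 by omega]; norm_num; omega
      · obtain rfl : m = 0 := by omega
        simp [show 0 < n by omega, show n ≠ 0 by omega]; norm_num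
    · have h' : (k : ℝ) + 1 ≤ m := by exact_mod_cast h
      rw [abs_of_nonneg (by linarith : 0 ≤ (m : ℝ) - k),
        abs_of_nonneg (by push_cast; linarith : 0 ≤ ((m + 1 : ℕ) : ℝ) - k),
        e1 (by omega), abs_of_nonneg (by linarith : 0 ≤ (m : ℝ) - 1 - k)]
      by_cases h2 : m < 3 * n
      · simp [h2, show 1 ≤ m by omega, show m ≠ k by omega, show m ≠ 0 by omega,
          show m ≠ 3 * n by omega]
        ring
      · simp only [show m = 3 * n by omega]
        simp [show 3 * n ≠ k by omega, show n ≠ 0 by omega, show 1 ≤ 3 * n by omega]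
        ring
  have hE : columnEigenvalue n m = (if 1 ≤ m then 2 else 0) + (if m < 3 * n then 2 else 0) +
      rungIndicator m + rungIndicator m := rfl
  by_cases h1 : 1 ≤ m <;> by_cases h2 : m < 3 * n <;>
    simp only [h1, h2, if_true, if_false] at hpath hE ⊢
  · linear_combination hpath - hL - hR - A * hE
  · linear_combination hpath - hL - A * hE
  · linear_combination hpath - hR - A * hE
  · linear_combination hpath - A * hE

/-- The resistance distances of the linear crossed octagonal graph. -/
theorem crossedOctagonalGraph_resistanceDist {n : ℕ} (hn : 1 ≤ n)
    (i j : Fin (3 * n + 1) × Bool) :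
    (crossedOctagonalGraph n).resistanceDist i j =
      |((i.1 : ℕ) : ℝ) - (j.1 : ℕ)| / 4 + 1 / (2 * columnEigenvalue n i.1) +
        1 / (2 * columnEigenvalue n j.1) -
        if i.1 = j.1 then boolSign i.2 j.2 / columnEigenvalue n i.1 else 0 := by
  have hv : (crossedOctagonalGraph n).IsUnitCurrentPotential i j fun x =>
      sourcePotential n i.1 i.2 x.1 x.2 - sourcePotential n j.1 j.2 x.1 x.2 := by
    intro x
    have h := congrArg₂ (· - ·) (sum_neighborFinset_sourcePotential hn i x)
      (sum_neighborFinset_sourcePotential hn j x)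
    simp only [← sum_sub_distrib] at h
    rw [sum_congr rfl fun y _ => sub_sub_sub_comm _ _ _ _, h]
    ring
  rw [hv.resistanceDist_eq]
  obtain ⟨k, s⟩ := i
  obtain ⟨l, t⟩ := j
  have hs : ∀ b, boolSign b b = 1 := fun b => by simp [boolSign]
  have hst : boolSign t s = boolSign s t := by simp [boolSign, eq_comm]
  simp only [sourcePotential, hs, hst, abs_sub_comm ((l : ℕ) : ℝ) ((k : ℕ) : ℝ), sub_self,
    abs_zero, if_true, Fin.ext_iff, eq_comm (a := (l : ℕ))]
  split_ifs with h
  · rw [h]; ring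
  · ring

/-! ### Reduction to ordered pairs. -/

theorem SimpleGraph.multDegreeKirchhoffIndex_eq_half_sum {V : Type*} [Fintype V] [DecidableEq V]
    (G : SimpleGraph V) [DecidableRel G.Adj] :
    G.multDegreeKirchhoffIndex =
      (∑ i, ∑ j, (G.degree i : ℝ) * G.degree j * G.resistanceDist i j) / 2 := by
  have hself : ∀ i, G.resistanceDist i i = 0 := by
    intro i
    have h : G.IsUnitCurrentPotential i i 0 := by intro x; simp
    simpa using h.resistanceDist_eq
  have hoff : ∑ i, ∑ j, (G.degree i : ℝ) * G.degree j * G.resistanceDist i j =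
      ∑ p ∈ (univ : Finset V).offDiag,
        (G.degree p.1 : ℝ) * G.degree p.2 * G.resistanceDist p.1 p.2 := by
    rw [← Fintype.sum_prod_type' fun i j => (G.degree i : ℝ) * G.degree j * G.resistanceDist i j]
    refine (sum_subset (subset_univ _) fun p _ hp => ?_).symm
    have : p.1 = p.2 := by simpa using hp
    rw [this, hself, mul_zero]
  have hmaps : ∀ p ∈ (univ : Finset V).offDiag,
      s(p.1, p.2) ∈ ({e : Sym2 V | ¬ e.IsDiag} : Finset (Sym2 V)) := by
    intro p hp
    simpa using hp
  rw [hoff, ← sum_fiberwise_of_maps_to hmaps, sum_div, SimpleGraph.multDegreeKirchhoffIndex]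
  refine sum_congr rfl fun e he => ?_
  induction e using Sym2.ind with
  | _ a b =>
    have hab : a ≠ b := by simpa using he
    have hfib : {p ∈ (univ : Finset V).offDiag | s(p.1, p.2) = s(a, b)} = {(a, b), (b, a)} := by
      ext ⟨c, d⟩
      simp only [mem_filter, mem_offDiag, mem_univ, true_and, Sym2.eq_iff, mem_insert,
        mem_singleton, Prod.mk.injEq]
      constructor
      · exact fun h => h.2
      · rintro (⟨rfl, rfl⟩ | ⟨rfl, rfl⟩)
        · exact ⟨hab, Or.inl ⟨rfl, rfl⟩⟩
        · exact ⟨hab.symm, Or.inr ⟨rfl, rfl⟩⟩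
    rw [hfib, sum_pair (by simp [hab]), Sym2.lift_mk, G.resistanceDist_comm b a]
    ring

/-! ### Sums over columns. -/

/-- The new index exceeds all the others, so its absolute values open up and only the zeroth and
first moments of `f` enter. -/
theorem sum_sum_mul_abs_sub_succ (f : ℕ → ℝ) (N : ℕ) :
    ∑ k ∈ range (N + 1), ∑ l ∈ range (N + 1), f k * f l * |(k : ℝ) - l| =
      ∑ k ∈ range N, ∑ l ∈ range N, f k * f l * |(k : ℝ) - l| +
        2 * f N * (N * ∑ k ∈ range N, f k - ∑ k ∈ range N, k * f k) := by
  have h : ∑ k ∈ range N, f k * f N * |(k : ℝ) - N| =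
      f N * (N * ∑ k ∈ range N, f k - ∑ k ∈ range N, k * f k) := by
    rw [mul_sum, ← sum_sub_distrib, mul_sum]
    refine sum_congr rfl fun k hk => ?_
    have : (k : ℝ) ≤ N := by exact_mod_cast (mem_range.mp hk).le
    rw [abs_of_nonpos (by linarith)]
    ring
  have h' : ∑ k ∈ range N, f N * f k * |(N : ℝ) - k| = ∑ k ∈ range N, f k * f N * |(k : ℝ) - N| :=
    sum_congr rfl fun k _ => by rw [abs_sub_comm, mul_comm (f N)]
  simp only [sum_range_succ, sum_add_distrib, h', h, sub_self, abs_zero]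
  ring

theorem columnDegree_last {n : ℕ} (hn : 1 ≤ n) : columnDegree n (3 * n) = 3 := by
  simp [columnDegree, rungIndicator, show 1 ≤ 3 * n by omega]; norm_num

/-- The column degrees of an infinite one-sided crossed octagonal graph. -/
def innerDegree (k : ℕ) : ℝ := (if 1 ≤ k then 4 else 2) + rungIndicator k

/-- Only the last column feels `n`. Below it the degrees form a fixed sequence, which permits
induction on `n`; the last column is adjoined afterwards. -/
theorem columnDegree_of_lt {n k : ℕ} (hk : k < 3 * n) : columnDegree n k = innerDegree k := by
  unfold columnDegree innerDegree
  split_ifs <;> norm_num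

theorem rungIndicator_three_mul (n : ℕ) :
    rungIndicator (3 * n) = 1 ∧ rungIndicator (3 * n + 1) = 0 ∧ rungIndicator (3 * n + 2) = 0 := by
  refine ⟨?_, ?_, ?_⟩ <;> unfold rungIndicator
  · simp
  · exact if_neg (by omega)
  · exact if_neg (by omega)

theorem innerDegree_three_mul {n : ℕ} (hn : 1 ≤ n) :
    innerDegree (3 * n) = 5 ∧ innerDegree (3 * n + 1) = 4 ∧ innerDegree (3 * n + 2) = 4 := by
  obtain ⟨h0, h1, h2⟩ := rungIndicator_three_mul n
  simp only [innerDegree, h0, h1, h2, show 1 ≤ 3 * n by omega, show 1 ≤ 3 * n + 1 by omega,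
    show 1 ≤ 3 * n + 2 by omega, if_true]
  norm_num

theorem innerDegree_first :
    innerDegree 0 = 3 ∧ innerDegree 1 = 4 ∧ innerDegree 2 = 4 := by
  norm_num [innerDegree, rungIndicator]

/-- Each block of three columns gives 5 + 4 + 4, except that column 0 has degree 3. -/
theorem sum_innerDegree {n : ℕ} (hn : 1 ≤ n) :
    ∑ k ∈ range (3 * n), innerDegree k = 13 * n - 2 := by
  induction n, hn using Nat.le_induction with
  | base =>
    obtain ⟨h0, h1, h2⟩ := innerDegree_first
    norm_num [sum_range_succ, h0, h1, h2]
  | succ n hn ih =>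
    obtain ⟨h0, h1, h2⟩ := innerDegree_three_mul hn
    rw [show 3 * (n + 1) = 3 * n + 1 + 1 + 1 by ring]
    simp only [sum_range_succ, ih, h0, h1, h2]
    push_cast; ring

/-- The block starting at column `3q` gives `39q + 12`; the smaller degree of column 0 has weight 0.
-/
theorem sum_mul_innerDegree {n : ℕ} (hn : 1 ≤ n) :
    ∑ k ∈ range (3 * n), k * innerDegree k = 12 * n + 39 * n * (n - 1) / 2 := by
  induction n, hn using Nat.le_induction with
  | base =>
    obtain ⟨h0, h1, h2⟩ := innerDegree_first
    norm_num [sum_range_succ, h0, h1, h2]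
  | succ n hn ih =>
    obtain ⟨h0, h1, h2⟩ := innerDegree_three_mul hn
    rw [show 3 * (n + 1) = 3 * n + 1 + 1 + 1 by ring]
    simp only [sum_range_succ, ih, h0, h1, h2]
    push_cast; ring

theorem sum_sum_innerDegree_mul_abs_sub {n : ℕ} (hn : 1 ≤ n) :
    ∑ k ∈ range (3 * n), ∑ l ∈ range (3 * n), innerDegree k * innerDegree l * |(k : ℝ) - l| =
      169 * n ^ 3 - 78 * n ^ 2 + 13 * n := by
  induction n, hn using Nat.le_induction with
  | base =>
    obtain ⟨h0, h1, h2⟩ := innerDegree_first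
    rw [show 3 * 1 = 0 + 1 + 1 + 1 by norm_num]
    rw [sum_sum_mul_abs_sub_succ, sum_sum_mul_abs_sub_succ, sum_sum_mul_abs_sub_succ]
    norm_num [sum_range_succ, h0, h1, h2]
  | succ n hn ih =>
    obtain ⟨h0, h1, h2⟩ := innerDegree_three_mul hn
    rw [show 3 * (n + 1) = 3 * n + 1 + 1 + 1 by ring]
    rw [sum_sum_mul_abs_sub_succ, sum_sum_mul_abs_sub_succ, sum_sum_mul_abs_sub_succ, ih]
    simp only [sum_range_succ, sum_innerDegree hn, sum_mul_innerDegree hn, h0, h1, h2]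
    push_cast; ring

/-- A block gives 5/6 + 1 + 1, but column 0 gives 3/4 instead of 5/6. -/
theorem sum_innerDegree_div {n : ℕ} (hn : 1 ≤ n) :
    ∑ k ∈ range (3 * n), innerDegree k / (innerDegree k + rungIndicator k) =
      17 * n / 6 - 1 / 12 := by
  induction n, hn using Nat.le_induction with
  | base =>
    obtain ⟨h0, h1, h2⟩ := innerDegree_first
    norm_num [sum_range_succ, h0, h1, h2, rungIndicator]
  | succ n hn ih =>
    obtain ⟨h0, h1, h2⟩ := innerDegree_three_mul hn
    obtain ⟨r0, r1, r2⟩ := rungIndicator_three_mul n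
    rw [show 3 * (n + 1) = 3 * n + 1 + 1 + 1 by ring]
    simp only [sum_range_succ, ih, h0, h1, h2, r0, r1, r2]
    push_cast; ring

theorem sum_columnDegree {n : ℕ} (hn : 1 ≤ n) :
    ∑ k ∈ range (3 * n + 1), columnDegree n k = 13 * n + 1 := by
  rw [sum_range_succ, columnDegree_last hn,
    sum_congr rfl fun k hk => columnDegree_of_lt (mem_range.mp hk), sum_innerDegree hn]
  ring

theorem sum_columnDegree_div_columnEigenvalue {n : ℕ} (hn : 1 ≤ n) :
    ∑ k ∈ range (3 * n + 1), columnDegree n k / columnEigenvalue n k = (17 * n + 4) / 6 := by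
  have h : ∀ k ∈ range (3 * n), columnDegree n k / columnEigenvalue n k =
      innerDegree k / (innerDegree k + rungIndicator k) := fun k hk => by
    rw [columnEigenvalue, columnDegree_of_lt (mem_range.mp hk)]
  rw [sum_range_succ, sum_congr rfl h, sum_innerDegree_div hn, columnEigenvalue,
    columnDegree_last hn, (rungIndicator_three_mul n).1]
  ring

theorem sum_sum_columnDegree_mul_abs_sub {n : ℕ} (hn : 1 ≤ n) :
    ∑ k ∈ range (3 * n + 1), ∑ l ∈ range (3 * n + 1),
        columnDegree n k * columnDegree n l * |(k : ℝ) - l| =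
      169 * n ^ 3 + 39 * n ^ 2 + 22 * n := by
  have h : ∀ k ∈ range (3 * n), columnDegree n k = innerDegree k :=
    fun k hk => columnDegree_of_lt (mem_range.mp hk)
  have h2 : ∀ k ∈ range (3 * n), ∑ l ∈ range (3 * n),
        columnDegree n k * columnDegree n l * |(k : ℝ) - l| =
      ∑ l ∈ range (3 * n), innerDegree k * innerDegree l * |(k : ℝ) - l| :=
    fun k hk => sum_congr rfl fun l hl => by rw [h k hk, h l hl]
  have h3 : ∀ k ∈ range (3 * n), k * columnDegree n k = k * innerDegree k :=
    fun k hk => by rw [h k hk]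
  rw [sum_sum_mul_abs_sub_succ, sum_congr rfl h2, sum_congr rfl h, sum_congr rfl h3, sum_sum_innerDegree_mul_abs_sub hn,
    sum_innerDegree hn, sum_mul_innerDegree hn, columnDegree_last hn]
  push_cast; ring

/-! ### Assembly. -/

theorem crossedOctagonalGraph_sum_sum {n : ℕ} (hn : 1 ≤ n) :
    ∑ i, ∑ j, ((crossedOctagonalGraph n).degree i : ℝ) * (crossedOctagonalGraph n).degree j *
        (crossedOctagonalGraph n).resistanceDist i j =
      ∑ k ∈ range (3 * n + 1), ∑ l ∈ range (3 * n + 1),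
        columnDegree n k * columnDegree n l * |(k : ℝ) - l| +
      4 * (∑ k ∈ range (3 * n + 1), columnDegree n k) *
        ∑ k ∈ range (3 * n + 1), columnDegree n k / columnEigenvalue n k := by
  have hprod : 4 * (∑ k ∈ range (3 * n + 1), columnDegree n k) *
        ∑ k ∈ range (3 * n + 1), columnDegree n k / columnEigenvalue n k =
      ∑ k ∈ range (3 * n + 1), ∑ l ∈ range (3 * n + 1),
        (2 * (columnDegree n k * (columnDegree n l / columnEigenvalue n l)) +
         2 * (columnDegree n l * (columnDegree n k / columnEigenvalue n k))) := by
    simp only [sum_add_distrib, ← mul_sum, ← sum_mul]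
    ring
  rw [hprod, ← sum_add_distrib, Fintype.sum_prod_type, sum_range]
  refine sum_congr rfl fun k _ => ?_
  rw [← sum_add_distrib, sum_range]
  simp only [Fintype.sum_prod_type]
  rw [Fintype.sum_bool, ← sum_add_distrib]
  refine sum_congr rfl fun l _ => ?_
  simp only [Fintype.sum_bool, crossedOctagonalGraph_degree,
    crossedOctagonalGraph_resistanceDist hn]
  -- Over the four choices of vertices in two columns the signs add up to 0, so the case of equal
  -- columns gives no extra term.
  split_ifs <;> simp [boolSign] <;> ring

theorem theorem1p3 (n : ℕ) (hn : 1 ≤ n) :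
    (crossedOctagonalGraph n).multDegreeKirchhoffIndex =
      (507 * (n : ℝ) ^ 3 + 559 * (n : ℝ) ^ 2 + 204 * (n : ℝ) + 8) / 6 := by
  rw [SimpleGraph.multDegreeKirchhoffIndex_eq_half_sum, crossedOctagonalGraph_sum_sum hn,
    sum_sum_columnDegree_mul_abs_sub hn, sum_columnDegree hn,
    sum_columnDegree_div_columnEigenvalue hn]
  ring
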